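/- Let $R$ be a commutative ring with identity. An ideal $I$ of $R$ is called dense if $\{r\in R\mid Ir=0\}=0$, and semi-regular if it contains a finitely generated dense subideal; let $\mathcal{Q}$ be the set of all finitely generated semi-regular ideals of $R$. A GV-ideal is a finitely generated ideal $J$ of $R$ such that the natural homomorphism $R\to \mathrm{Hom}_R(J,R)$, $r\mapsto (j\mapsto rj)$, is an isomorphism. An $R$-module $T$ is GV-torsion if for every $x\in T$ there is a GV-ideal $J$ with $Jx=0$. An $R$-module $M$ is semi-regular $w$-flat if $\mathrm{Tor}_1^R(R/I,M)$ is GV-torsion for all $I\in\mathcal{Q}$; let $w\text{-}\mathcal{F}_{sr}$ be the class of all semi-regular $w$-flat $R$-modules. Then $w\text{-}\mathcal{F}_{sr}$ is closed under direct limits (over nonempty directed index sets), pure submodules and pure quotients (a submodule $N\subseteq M$ is pure if $X\otimes_R N\to X\otimes_R M$ is injective for every $R$-module $X$, and then $M/N$ is called a pure quotient of $M$). Consequently, $w\text{-}\mathcal{F}_{sr}$ is a covering class: for every $R$-module $M$ there is a homomorphism $f:F\to M$ with $F\in w\text{-}\mathcal{F}_{sr}$ such that $\mathrm{Hom}_R(F',F)\to\mathrm{Hom}_R(F',M)$,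 $g\mapsto f\circ g$, is surjective for every $F'\in w\text{-}\mathcal{F}_{sr}$, and such that every endomorphism $h$ of $F$ with $f=f\circ h$ is an isomorphism. -/

import Mathlib

open CategoryTheory

universe u

section Ideals

variable {R : Type u} [CommRing R]

/-- An ideal is dense if its annihilator is zero. -/
def Ideal.IsDense (I : Ideal R) : Prop :=
  ∀ r : R, (∀ a ∈ I, a * r = 0) → r = 0

/-- An ideal is semi-regular if it contains a finitely generated dense subideal. -/
def Ideal.IsSemiRegular (I : Ideal R) : Prop :=
  ∃ I₀ : Ideal R, I₀ ≤ I ∧ I₀.FG ∧ I₀.IsDense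

/-- A Glaz-Vasconcelos ideal: a finitely generated ideal `J` such that the natural homomorphism
from `R` to `Hom_R(J, R)`, sending `r` to multiplication by `r`, is an isomorphism. -/
def Ideal.IsGV (J : Ideal R) : Prop :=
  J.FG ∧ Function.Bijective (LinearMap.toSpanSingleton R (J →ₗ[R] R) J.subtype)

end Ideals

section Modules

variable (R : Type u) [CommRing R]

/-- A module is GV-torsion if each of its elements is annihilated by some GV-ideal. -/
def Module.IsGVTorsion (M : Type*) [AddCommGroup M] [Module R M] : Prop :=
  ∀ x : M, ∃ J : Ideal R, J.IsGV ∧ ∀ a ∈ J, a • x = 0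

/-- The class of semi-regular `w`-flat modules: those `M` such that `Tor₁(R/I, M)` is GV-torsion
for every finitely generated semi-regular ideal `I`. -/
def semiRegularWFlat : ObjectProperty (ModuleCat.{u} R) := fun M =>
  ∀ I : Ideal R, I.FG → I.IsSemiRegular →
    Module.IsGVTorsion R (((Tor (ModuleCat.{u} R) 1).obj (ModuleCat.of R (R ⧸ I))).obj M)

variable {R}

/-- A submodule `N` of `M` is pure if `X ⊗ N → X ⊗ M` is injective for every module `X`,
i.e. if `0 → N → M → M/N → 0` stays exact after tensoring with any module. -/
def Submodule.IsPure {M : Type u} [AddCommGroup M] [Module R M] (N : Submodule R M) : Prop :=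
  ∀ (X : Type u) [AddCommGroup X] [Module R X], Function.Injective (N.subtype.lTensor X)

namespace CategoryTheory.ObjectProperty

variable (P : ObjectProperty (ModuleCat.{u} R))

/-- Closure under direct limits, i.e. under colimits of direct systems indexed by
nonempty directed preordered sets. -/
def ClosedUnderDirectLimits : Prop :=
  ∀ (ι : Type u) [Preorder ι] [IsDirectedOrder ι] [Nonempty ι],
    P.IsClosedUnderColimitsOfShape ι

/-- Closure under pure submodules. -/
def ClosedUnderPureSubmodules : Prop :=
  ∀ (M : ModuleCat.{u} R) (N : Submodule R M), N.IsPure → P M → P (ModuleCat.of R N)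

/-- Closure under pure quotients, i.e. quotients by pure submodules. -/
def ClosedUnderPureQuotients : Prop :=
  ∀ (M : ModuleCat.{u} R) (N : Submodule R M), N.IsPure → P M → P (ModuleCat.of R (M ⧸ N))

/-- `f : F ⟶ M` is a `P`-precover of `M` if `F` is in `P` and every morphism to `M` from an
object of `P` factors through `f`. -/
def IsPrecover {F M : ModuleCat.{u} R} (f : F ⟶ M) : Prop :=
  P F ∧ ∀ F' : ModuleCat.{u} R, P F' → Function.Surjective (fun g : F' ⟶ F => g ≫ f)

/-- `f : F ⟶ M` is a `P`-cover of `M` if it is a `P`-precover and every endomorphism `h` of `F`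
with `f ∘ h = f` is an isomorphism. -/
def IsCover {F M : ModuleCat.{u} R} (f : F ⟶ M) : Prop :=
  P.IsPrecover f ∧ ∀ h : F ⟶ F, h ≫ f = f → IsIso h

/-- `P` is a covering class if every module has a `P`-cover. -/
def IsCovering : Prop :=
  ∀ M : ModuleCat.{u} R, ∃ (F : ModuleCat.{u} R) (f : F ⟶ M), P.IsCover f

end CategoryTheory.ObjectProperty

end Modules

/-! A projective resolution of `M` and the snake lemma identify Tor₁(R/I, M) with ker(I ⊗ M → R ⊗ M)
well enough to transfer GV-torsion (`isGVTorsion_tor_one_iff`). The class is thus cut out, one ideal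
at a time, by requiring these kernels to be GV-torsion. GV-torsion elements are preserved by
homomorphisms and reflected by injections, and an element that a GV-ideal multiplies into the
torsion is itself torsion. Closure under direct limits, pure submodules, pure quotients, extensions
and direct sums follows by chasing these kernels.

Precovers: each element of a module lies in a pure submodule of cardinality at most κ = max(#R, ℵ₀),
and such a submodule is a quotient T/K of the free module T of rank κ. The small object argument for
the inclusions K → T with T/K in the class, applied to 0 → M, yields p : F → M with the right
lifting property. F is built from 0 by extensions, sums and direct limits, so it is in the class
(`exists_rlp_testMaps`). A map F' → M with F' in the class lifts through p by Zorn's lemma on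
partial lifts with pure domain (`exists_lift_of_rlp_testMaps`).

Covers, after Enochs: a precover of M is a weakly terminal object among the members of the class
over M, where directed colimits exist. Two transfinite iterations, each stopped by a cardinality
count, replace it by an object whose endomorphisms are all bijective
(`exists_forall_endomorphism_bijective`). -/

/-! ### GV-ideals and GV-torsion. -/

section GVTorsion

open TensorProduct

variable {R : Type u} [CommRing R]

lemma Ideal.isGV_top : (⊤ : Ideal R).IsGV := by
  refine ⟨Module.Finite.fg_top, fun r s h => ?_, fun φ => ?_⟩
  · simpa using LinearMap.congr_fun h (⟨1, trivial⟩ : (⊤ : Ideal R))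
  · refine ⟨φ ⟨1, trivial⟩, LinearMap.ext fun x => ?_⟩
    have : x = (x : R) • (⟨1, trivial⟩ : (⊤ : Ideal R)) := by ext; simp
    conv_rhs => rw [this, map_smul]
    simp [mul_comm]

lemma Ideal.IsGV.eq_zero {J : Ideal R} (hJ : J.IsGV) {r : R} (h : ∀ a ∈ J, a * r = 0) : r = 0 :=
  hJ.2.1 (LinearMap.ext fun x => by simpa [mul_comm] using h x x.2)

lemma Ideal.IsGV.exists_eq_mul {J : Ideal R} (hJ : J.IsGV) (φ : J →ₗ[R] R) :
    ∃ r : R, ∀ x : J, φ x = r * x := by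
  obtain ⟨r, rfl⟩ := hJ.2.2 φ
  exact ⟨r, fun x => by simp⟩

/-- This is Hom(JK, R) ≅ Hom(K, Hom(J, R)) ≅ R made explicit: for fixed b in K, the map a ↦ φ(ab) is
multiplication by some g(b). Since J has zero annihilator, g is linear on K, hence is itself a
multiplication. -/
lemma Ideal.IsGV.mul {J K : Ideal R} (hJ : J.IsGV) (hK : K.IsGV) : (J * K).IsGV := by
  have key (r : R) (h : ∀ a ∈ J * K, a * r = 0) : r = 0 :=
    hK.eq_zero fun b hb => hJ.eq_zero fun a ha => by
      rw [← mul_assoc]; exact h _ (Ideal.mul_mem_mul ha hb)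
  refine ⟨hJ.1.mul hK.1, fun r s h => ?_, fun φ => ?_⟩
  · refine sub_eq_zero.1 (key _ fun a ha => ?_)
    have := LinearMap.congr_fun h ⟨a, ha⟩
    simp only [LinearMap.toSpanSingleton_apply, LinearMap.smul_apply, Submodule.subtype_apply,
      smul_eq_mul] at this
    linear_combination this
  · let ψ (b : K) : J →ₗ[R] R :=
      { toFun a := φ ⟨a * b, Ideal.mul_mem_mul a.2 b.2⟩
        map_add' a a' := by rw [← map_add]; congr 1; ext; simp [add_mul]
        map_smul' c a := by
          rw [RingHom.id_apply, ← map_smul]; congr 1; ext; simp [mul_assoc] }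
    choose g hg using fun b => hJ.exists_eq_mul (ψ b)
    have hg' (a : J) (b : K) : φ ⟨a * b, Ideal.mul_mem_mul a.2 b.2⟩ = g b * a := hg b a
    let χ : K →ₗ[R] R :=
      { toFun := g
        map_add' b b' := by
          refine sub_eq_zero.1 (hJ.eq_zero fun a ha => ?_)
          have h1 := hg' ⟨a, ha⟩ (b + b')
          have h2 := hg' ⟨a, ha⟩ b
          have h3 := hg' ⟨a, ha⟩ b'
          have h4 : φ ⟨a * (b + b' : K), Ideal.mul_mem_mul ha (b + b').2⟩ =
              φ ⟨a * b, Ideal.mul_mem_mul ha b.2⟩ + φ ⟨a * b', Ideal.mul_mem_mul ha b'.2⟩ := by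
            rw [← map_add]; congr 1; ext; simp [mul_add]
          simp only at h1 h2 h3
          linear_combination -h1 + h2 + h3 + h4
        map_smul' c b := by
          refine sub_eq_zero.1 (hJ.eq_zero fun a ha => ?_)
          have h1 := hg' ⟨a, ha⟩ (c • b)
          have h2 := hg' ⟨a, ha⟩ b
          have h4 : φ ⟨a * (c • b : K), Ideal.mul_mem_mul ha (c • b).2⟩ =
              c • φ ⟨a * b, Ideal.mul_mem_mul ha b.2⟩ := by
            rw [← map_smul]; congr 1; ext; simp [mul_left_comm]
          simp only [smul_eq_mul, RingHom.id_apply] at h1 h2 h4 ⊢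
          linear_combination -h1 + c * h2 + h4 }
    obtain ⟨r, hr⟩ := hK.exists_eq_mul χ
    refine ⟨r, LinearMap.ext fun ⟨x, hx⟩ => ?_⟩
    simp only [LinearMap.toSpanSingleton_apply, LinearMap.smul_apply, Submodule.subtype_apply,
      smul_eq_mul]
    refine Submodule.mul_induction_on' (C := fun x hx => r * x = φ ⟨x, hx⟩)
      (fun a ha b hb => ?_) (fun x hx y hy h h' => ?_) hx
    · have h1 := hg' ⟨a, ha⟩ ⟨b, hb⟩
      have h2 : g ⟨b, hb⟩ = r * b := hr ⟨b, hb⟩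
      simp only at h1
      rw [h1, h2]; ring
    · have : (⟨x + y, add_mem hx hy⟩ : (J * K : Ideal R)) = ⟨x, hx⟩ + ⟨y, hy⟩ := rfl
      rw [this, map_add, ← h, ← h', mul_add]

variable (R) in
/-- The GV-torsion submodule. -/
def Module.gvTorsion (M : Type*) [AddCommGroup M] [Module R M] : Submodule R M where
  carrier := {x | ∃ J : Ideal R, J.IsGV ∧ ∀ a ∈ J, a • x = 0}
  zero_mem' := by
    rw [Set.mem_ofPred_eq]
    exact ⟨⊤, Ideal.isGV_top, fun a _ => smul_zero a⟩
  add_mem' := by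
    intro x y hx hy
    rw [Set.mem_ofPred_eq] at hx hy ⊢
    obtain ⟨J, hJ, hx⟩ := hx
    obtain ⟨K, hK, hy⟩ := hy
    refine Exists.intro (J * K) (And.intro (hJ.mul hK) fun a ha => ?_)
    rw [smul_add, hx a (Ideal.mul_le_left ha), hy a (Ideal.mul_le_right ha), add_zero]
  smul_mem' := by
    rintro c x ⟨J, hJ, hx⟩
    exact ⟨J, hJ, fun a ha => by rw [smul_comm, hx a ha, smul_zero]⟩

namespace Module

variable {M N : Type*} [AddCommGroup M] [Module R M] [AddCommGroup N] [Module R N]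

lemma isGVTorsion_iff : IsGVTorsion R M ↔ ∀ x : M, x ∈ gvTorsion R M := Iff.rfl

lemma map_mem_gvTorsion (f : M →ₗ[R] N) {x : M} (hx : x ∈ gvTorsion R M) :
    f x ∈ gvTorsion R N := by
  obtain ⟨J, hJ, h⟩ := hx
  exact ⟨J, hJ, fun a ha => by rw [← map_smul, h a ha, map_zero]⟩

lemma mem_gvTorsion_of_injective (f : M →ₗ[R] N) (hf : Function.Injective f) {x : M}
    (hx : f x ∈ gvTorsion R N) : x ∈ gvTorsion R M := by
  obtain ⟨J, hJ, h⟩ := hx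
  exact ⟨J, hJ, fun a ha => hf (by rw [map_smul, h a ha, map_zero])⟩

lemma isGVTorsion_congr (e : M ≃ₗ[R] N) : IsGVTorsion R M ↔ IsGVTorsion R N :=
  ⟨fun h => isGVTorsion_iff.2 fun x => by
      simpa using map_mem_gvTorsion e.toLinearMap (isGVTorsion_iff.1 h (e.symm x)),
    fun h => isGVTorsion_iff.2 fun x => by
      simpa using map_mem_gvTorsion e.symm.toLinearMap (isGVTorsion_iff.1 h (e x))⟩

/-- J has finitely many generators, so the product K of GV-ideals killing their multiples of x is
again GV, and KJ kills x. This is what gives closure under extensions. -/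
lemma mem_gvTorsion_of_smul_mem {J : Ideal R} (hJ : J.IsGV) {x : M}
    (h : ∀ a ∈ J, a • x ∈ gvTorsion R M) : x ∈ gvTorsion R M := by
  classical
  obtain ⟨s, hs⟩ := hJ.1
  have : ∃ K : Ideal R, K.IsGV ∧ ∀ b ∈ K, ∀ a ∈ s, b • a • x = 0 := by
    have hs' : ∀ a ∈ s, a • x ∈ gvTorsion R M := fun a ha =>
      h a (hs ▸ Ideal.subset_span ha)
    clear hs
    induction s using Finset.induction_on with
    | empty => exact ⟨⊤, Ideal.isGV_top, by simp⟩
    | insert a s _ ih =>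
      obtain ⟨K, hK, h1⟩ := ih fun b hb => hs' b (Finset.mem_insert_of_mem hb)
      obtain ⟨L, hL, h2⟩ := hs' a (Finset.mem_insert_self _ _)
      refine ⟨K * L, hK.mul hL, fun b hb c hc => ?_⟩
      obtain rfl | hc := Finset.mem_insert.1 hc
      · exact h2 b (Ideal.mul_le_right hb)
      · exact h1 b (Ideal.mul_le_left hb) c hc
  obtain ⟨K, hK, h1⟩ := this
  refine ⟨K * J, hK.mul hJ, fun c hc => ?_⟩
  refine Submodule.mul_induction_on hc (fun b hb a ha => ?_) fun c d hc hd => ?_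
  · rw [mul_smul]
    rw [← hs] at ha
    refine Submodule.span_induction (p := fun a _ => b • a • x = 0) (fun a ha => h1 b hb a ha)
      (by simp) (fun a a' _ _ h h' => by simp [add_smul, h, h']) (fun r a _ h => ?_) ha
    rw [smul_eq_mul, mul_smul, smul_comm b r, h, smul_zero]
  · rw [add_smul, hc, hd, add_zero]

end Module

end GVTorsion

/-! ### Tor₁ as the kernel of I ⊗ M → R ⊗ M. -/

section Tor

open TensorProduct Module

/-- For a presentation `P₁ → P₀ → M → 0` with `P₀` flat, the middle homology of
`R/I ⊗ P₂ → R/I ⊗ P₁ → R/I ⊗ P₀` is GV-torsion iff the kernel of `I ⊗ M → R ⊗ M` is. -/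
lemma Module.rTensor_ker_le_gvTorsion_iff {R : Type*} [CommRing R] (I : Ideal R)
    {P₀ K M : Type*} [AddCommGroup P₀] [Module R P₀] [AddCommGroup K] [Module R K]
    [AddCommGroup M] [Module R M] [Module.Flat R P₀] (i : K →ₗ[R] P₀) (π : P₀ →ₗ[R] M)
    (hi : Function.Injective i) (hex : Function.Exact i π) (hπ : Function.Surjective π) :
    (∀ x : (R ⧸ I) ⊗[R] K, i.lTensor (R ⧸ I) x = 0 → x ∈ gvTorsion R _) ↔
      ∀ x : I ⊗[R] M, I.subtype.rTensor M x = 0 → x ∈ gvTorsion R _ := by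
  have hI : Function.Exact I.subtype (Submodule.mkQ I) := LinearMap.exact_subtype_mkQ I
  have hIs : Function.Surjective (Submodule.mkQ I) := Submodule.mkQ_surjective I
  have e₁ := lTensor_exact I hex hπ
  have e₂ := lTensor_exact R hex hπ
  have c₁ := rTensor_exact K hI hIs
  have c₂ := rTensor_exact P₀ hI hIs
  have s₁ : Function.Surjective (π.lTensor I) := LinearMap.lTensor_surjective _ hπ
  have s₂ : Function.Surjective ((Submodule.mkQ I).rTensor K) :=
    LinearMap.rTensor_surjective _ hIs
  have j₁ : Function.Injective (i.lTensor R) := Module.Flat.lTensor_preserves_injective_linearMap _ hi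
  have j₂ : Function.Injective (I.subtype.rTensor P₀) :=
    Module.Flat.rTensor_preserves_injective_linearMap _ Subtype.val_injective
  have q₁ : i.lTensor R ∘ₗ I.subtype.rTensor K = I.subtype.rTensor P₀ ∘ₗ i.lTensor I := by
    ext; simp
  have q₂ : π.lTensor R ∘ₗ I.subtype.rTensor P₀ = I.subtype.rTensor M ∘ₗ π.lTensor I := by
    ext; simp
  have q₃ : i.lTensor (R ⧸ I) ∘ₗ (Submodule.mkQ I).rTensor K =
      (Submodule.mkQ I).rTensor P₀ ∘ₗ i.lTensor R := by
    ext; simp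
  let Z := LinearMap.ker (I.subtype.rTensor M)
  have hZ : Function.Exact Z.subtype (I.subtype.rTensor M) := LinearMap.exact_subtype_ker_map _
  -- Connecting map of the snake lemma for the rows I ⊗ (K → P₀ → M) and R ⊗ (K → P₀ → M). It
  -- identifies Z with the kernel of R/I ⊗ K → R/I ⊗ P₀.
  let δ : Z →ₗ[R] (R ⧸ I) ⊗[R] K := SnakeLemma.δ' (K₃ := Z)
    (I.subtype.rTensor K) (I.subtype.rTensor P₀) (I.subtype.rTensor M)
    (i.lTensor I) (π.lTensor I) e₁ (i.lTensor R) (π.lTensor R) e₂ q₁ q₂ Z.subtype hZ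
    ((Submodule.mkQ I).rTensor K) c₁ s₁ j₁
  have hδ : Function.Exact δ (i.lTensor (R ⧸ I)) :=
    SnakeLemma.exact_δ'_left _ _ _ _ _ _ _ _ _ _ _ _ _ _ _ _ c₂ s₁ j₁ _ q₃ s₂
  have hδi : Function.Injective δ := by
    -- `PUnit` plays the kernel of I ⊗ P₀ → R ⊗ P₀, which is zero by flatness.
    have : Function.Exact (0 : PUnit →ₗ[R] Z) δ :=
      SnakeLemma.exact_δ'_right _ _ _ _ _ _ _ _ _ _ _ (0 : PUnit →ₗ[R] I ⊗[R] P₀)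
        (fun x => by
          rw [← map_zero (I.subtype.rTensor P₀), j₂.eq_iff]
          simp [eq_comm]) _ _ _ _ s₁ j₁ _ (by ext; simp) Subtype.val_injective
    rw [injective_iff_map_eq_zero]
    intro x hx
    obtain ⟨_, rfl⟩ := (this x).1 hx
    rfl
  constructor
  · intro h x hx
    have : (⟨x, hx⟩ : Z) ∈ gvTorsion R Z :=
      mem_gvTorsion_of_injective (M := Z) (N := (R ⧸ I) ⊗[R] K) δ hδi
        (h (δ ⟨x, hx⟩) (hδ.apply_apply_eq_zero _))
    exact map_mem_gvTorsion Z.subtype this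
  · intro h x hx
    obtain ⟨z, rfl⟩ := (hδ x).1 hx
    have : z ∈ gvTorsion R Z :=
      mem_gvTorsion_of_injective (M := Z) (N := I ⊗[R] M) Z.subtype Z.subtype_injective
        (h (Z.subtype z) z.2)
    exact map_mem_gvTorsion δ this

lemma CategoryTheory.ShortComplex.isGVTorsion_homology_iff {R : Type u} [CommRing R]
    (S : ShortComplex (ModuleCat.{u} R)) :
    IsGVTorsion R S.homology ↔
      ∀ z : S.X₂, S.g z = 0 → ∃ J : Ideal R, J.IsGV ∧ ∀ a ∈ J, a • z ∈ LinearMap.range S.f.hom := by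
  rw [isGVTorsion_congr S.moduleCatHomologyIso.toLinearEquiv]
  have key (z : LinearMap.ker S.g.hom) (a : R) :
      a • (LinearMap.range S.moduleCatToCycles).mkQ z = 0 ↔
        a • (z : S.X₂) ∈ LinearMap.range S.f.hom := by
    rw [← map_smul, Submodule.mkQ_apply, Submodule.Quotient.mk_eq_zero]
    constructor
    · rintro ⟨y, hy⟩
      exact ⟨y, congrArg Subtype.val hy⟩
    · rintro ⟨y, hy⟩
      exact ⟨y, Subtype.ext hy⟩
  constructor
  · intro h z hz
    obtain ⟨J, hJ, h⟩ := h ((LinearMap.range S.moduleCatToCycles).mkQ ⟨z, hz⟩)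
    exact ⟨J, hJ, fun a ha => (key ⟨z, hz⟩ a).1 (h a ha)⟩
  · intro h x
    obtain ⟨z, rfl⟩ := Submodule.mkQ_surjective (LinearMap.range S.moduleCatToCycles) x
    obtain ⟨J, hJ, h⟩ := h z z.2
    exact ⟨J, hJ, fun a ha => (key z a).2 (h a ha)⟩

/-- With K the image of P₁ → P₀, right exactness makes R/I ⊗ K the cokernel of R/I ⊗ P₂ → R/I ⊗ P₁,
so the first homology is the kernel of R/I ⊗ K → R/I ⊗ P₀. -/
lemma isGVTorsion_tor_one_iff {R : Type u} [CommRing R] (I : Ideal R) (M : ModuleCat.{u} R) :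
    IsGVTorsion R (((Tor (ModuleCat.{u} R) 1).obj (ModuleCat.of R (R ⧸ I))).obj M) ↔
      ∀ x : I ⊗[R] M, I.subtype.rTensor M x = 0 → x ∈ gvTorsion R _ := by
  let P := projectiveResolution M
  let F := (MonoidalCategory.tensoringLeft (ModuleCat.{u} R)).obj (ModuleCat.of R (R ⧸ I))
  let e₁ : ((Tor (ModuleCat.{u} R) 1).obj (ModuleCat.of R (R ⧸ I))).obj M ≅ _ :=
    P.isoLeftDerivedObj F 1
  let C := (F.mapHomologicalComplex _).obj P.complex
  let e₂ : C.homology 1 ≅ (C.sc' 2 1 0).homology :=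
    ShortComplex.homologyMapIso (C.isoSc' 2 1 0 (by simp) (by simp))
  rw [isGVTorsion_congr (e₁ ≪≫ e₂).toLinearEquiv, ShortComplex.isGVTorsion_homology_iff]
  have : Module.Flat R (P.complex.X 0) := by
    have := P.projective 0
    have := (IsProjective.iff_projective (R := R) (P := P.complex.X 0)).2 this
    infer_instance
  let π : P.complex.X 0 →ₗ[R] M := (P.π.f 0).hom
  have hπ : Function.Surjective π := (ModuleCat.epi_iff_surjective _).1 inferInstance
  let d₁ := (P.complex.d 1 0).hom
  let d₂ := (P.complex.d 2 1).hom
  have h₁₀ : Function.Exact d₁ π :=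
    (ShortComplex.ShortExact.moduleCat_exact_iff_function_exact _).1
      (ShortComplex.exact_of_g_is_cokernel (.mk _ _ P.complex_d_comp_π_f_zero)
        P.isColimitCokernelCofork)
  have h₂₁ : Function.Exact d₂ d₁ :=
    (ShortComplex.ShortExact.moduleCat_exact_iff_function_exact _).1 (P.exact_succ 0)
  let p := d₁.rangeRestrict
  have hp : Function.Surjective p := d₁.surjective_rangeRestrict
  have h₂p : Function.Exact d₂ p := by
    rw [LinearMap.exact_iff, LinearMap.ker_rangeRestrict, ← LinearMap.exact_iff]
    exact h₂₁
  have hp' := lTensor_exact (R ⧸ I) h₂p hp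
  rw [← rTensor_ker_le_gvTorsion_iff I (LinearMap.range d₁).subtype π
    (Submodule.subtype_injective _) (by
      rw [LinearMap.exact_iff, Submodule.range_subtype, ← LinearMap.exact_iff]; exact h₁₀) hπ]
  have hg (z : (R ⧸ I) ⊗[R] P.complex.X 1) : (C.sc' 2 1 0).g z =
      (LinearMap.range d₁).subtype.lTensor (R ⧸ I) (p.lTensor (R ⧸ I) z) := by
    rw [← LinearMap.lTensor_comp_apply]
    rfl
  have hf (z : (R ⧸ I) ⊗[R] P.complex.X 1) :
      z ∈ LinearMap.range (C.sc' 2 1 0).f.hom ↔ p.lTensor (R ⧸ I) z = 0 := by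
    exact (hp' z).symm
  constructor
  · intro h x hx
    obtain ⟨z, rfl⟩ := LinearMap.lTensor_surjective (R ⧸ I) hp x
    obtain ⟨J, hJ, h⟩ := h z ((hg z).trans hx)
    exact ⟨J, hJ, fun a ha => by rw [← map_smul]; exact (hf _).1 (h a ha)⟩
  · intro h z hz
    obtain ⟨J, hJ, h⟩ := h (p.lTensor (R ⧸ I) z) ((hg z).symm.trans hz)
    exact ⟨J, hJ, fun a ha => (hf _).2 (((p.lTensor (R ⧸ I)).map_smul a z).trans (h a ha))⟩

end Tor

/-! ### Closure properties, one ideal at a time. -/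

section WFlatAt

open TensorProduct Module Limits

variable {R : Type u} [CommRing R] (I : Ideal R)

/-- The kernel of `I ⊗ M → R ⊗ M` (i.e. `Tor₁(R/I, M)`) is GV-torsion. -/
def Module.IsWFlatAt (M : Type*) [AddCommGroup M] [Module R M] : Prop :=
  ∀ x : I ⊗[R] M, I.subtype.rTensor M x = 0 → x ∈ gvTorsion R (I ⊗[R] M)

lemma semiRegularWFlat_iff (M : ModuleCat.{u} R) :
    semiRegularWFlat R M ↔ ∀ I : Ideal R, I.FG → I.IsSemiRegular → IsWFlatAt I M :=
  forall_congr' fun I => imp_congr_right fun _ => imp_congr_right fun _ =>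
    isGVTorsion_tor_one_iff I M

namespace Module.IsWFlatAt

variable {I} {M N : Type*} [AddCommGroup M] [Module R M] [AddCommGroup N] [Module R N]

lemma rTensor_lTensor {A B : Type*} [AddCommGroup A] [Module R A] [AddCommGroup B] [Module R B]
    (g : A →ₗ[R] B) (f : N →ₗ[R] M) (x : A ⊗[R] N) :
    g.rTensor M (f.lTensor A x) = f.lTensor B (g.rTensor N x) := by
  rw [← LinearMap.comp_apply, ← LinearMap.comp_apply, LinearMap.rTensor_comp_lTensor,
    LinearMap.lTensor_comp_rTensor]

lemma of_injective_lTensor (h : IsWFlatAt I M) (f : N →ₗ[R] M)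
    (hf : Function.Injective (f.lTensor I)) : IsWFlatAt I N := fun x hx =>
  mem_gvTorsion_of_injective (f.lTensor I) hf (h _ (by rw [rTensor_lTensor, hx, map_zero]))

lemma of_equiv (h : IsWFlatAt I M) (e : N ≃ₗ[R] M) : IsWFlatAt I N :=
  h.of_injective_lTensor e.toLinearMap (e.lTensor I).injective

/-- Kernel elements for M/N lift to kernel elements for M. A lift y maps into R ⊗ N, and purity
against R/I shows that this image comes from some w in I ⊗ N; then y - w is the corrected lift. -/
lemma quotient (h : IsWFlatAt I M) (N : Submodule R M)
    (hN : Function.Injective (N.subtype.lTensor (R ⧸ I))) : IsWFlatAt I (M ⧸ N) := by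
  intro x hx
  have hex : Function.Exact N.subtype N.mkQ := LinearMap.exact_subtype_mkQ N
  obtain ⟨y, rfl⟩ := LinearMap.lTensor_surjective I N.mkQ_surjective x
  rw [rTensor_lTensor] at hx
  obtain ⟨n, hn⟩ := (lTensor_exact R hex N.mkQ_surjective _).1 hx
  have hI : Function.Exact I.subtype (Submodule.mkQ I) := LinearMap.exact_subtype_mkQ I
  have hIs := Submodule.mkQ_surjective I
  obtain ⟨w, rfl⟩ := (rTensor_exact N hI hIs n).1 (hN (by
    rw [← rTensor_lTensor, hn, (rTensor_exact M hI hIs).apply_apply_eq_zero, map_zero]))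
  have hy : I.subtype.rTensor M (y - N.subtype.lTensor I w) = 0 := by
    rw [map_sub, rTensor_lTensor, hn, sub_self]
  have := map_mem_gvTorsion (N.mkQ.lTensor I) (h _ hy)
  rwa [map_sub, (lTensor_exact I hex N.mkQ_surjective).apply_apply_eq_zero, sub_zero] at this

lemma of_extension (N : Submodule R M) (h₁ : IsWFlatAt I N) (h₂ : IsWFlatAt I (M ⧸ N)) :
    IsWFlatAt I M := by
  intro x hx
  have hex : Function.Exact N.subtype N.mkQ := LinearMap.exact_subtype_mkQ N
  obtain ⟨J, hJ, h⟩ := h₂ (N.mkQ.lTensor I x) (by rw [rTensor_lTensor, hx, map_zero])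
  refine mem_gvTorsion_of_smul_mem hJ fun a ha => ?_
  obtain ⟨y, hy⟩ := (lTensor_exact I hex N.mkQ_surjective (a • x)).1 (by rw [map_smul, h a ha])
  rw [← hy]
  refine map_mem_gvTorsion _ (h₁ y ?_)
  have : Function.Injective (N.subtype.lTensor R) :=
    Module.Flat.lTensor_preserves_injective_linearMap _ N.subtype_injective
  exact this (by rw [← rTensor_lTensor, hy, map_smul, hx, smul_zero, map_zero])

lemma directSum {ι : Type*} {M : ι → Type*} [∀ i, AddCommGroup (M i)] [∀ i, Module R (M i)]
    (h : ∀ i, IsWFlatAt I (M i)) : IsWFlatAt I (DirectSum ι M) := by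
  classical
  intro x hx
  let e := directSumRight R R I M
  have key (i : ι) : e x i ∈ gvTorsion R (I ⊗[R] M i) := by
    refine h i _ ?_
    have := LinearMap.congr_fun (directSumRight_comp_rTensor (M₁ := M) R I.subtype) x
    rw [LinearMap.comp_apply, hx, map_zero] at this
    exact (DFunLike.congr_fun this i).symm
  have hx' : x = ∑ i ∈ DFinsupp.support (e x),
      (e.symm.toLinearMap ∘ₗ DirectSum.lof R ι (fun i => I ⊗[R] M i) i) (e x i) := by
    conv_lhs => rw [← e.symm_apply_apply x, ← DirectSum.sum_support_of (e x), map_sum]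
    rfl
  rw [hx']
  exact Submodule.sum_mem _ fun i _ => map_mem_gvTorsion _ (key i)

/-- A kernel element is represented at some stage i. Its image under I ⊗ F(i) → R ⊗ F(i) ≅ F(i) dies
in the colimit, hence at a later stage j, where the representative lies in the kernel. -/
lemma of_isColimit {ι : Type u} [Preorder ι] [IsDirectedOrder ι] [Nonempty ι]
    {F : ι ⥤ ModuleCat.{u} R} {c : Cocone F} (hc : IsColimit c)
    (h : ∀ i, IsWFlatAt I (F.obj i)) : IsWFlatAt I c.pt := by
  let g (i : ι) : F.obj i →ₗ[R] c.pt := (c.ι.app i).hom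
  have hg {i j : ι} (f : i ⟶ j) : g j ∘ₗ (F.map f).hom = g i :=
    congrArg ModuleCat.Hom.hom (c.w f)
  have hrep (x : I ⊗[R] c.pt) : ∃ (i : ι) (y : I ⊗[R] F.obj i), (g i).lTensor I y = x := by
    induction x with
    | zero => exact ⟨Classical.arbitrary ι, 0, map_zero _⟩
    | tmul a m =>
      obtain ⟨i, y, rfl⟩ := Concrete.isColimit_exists_rep F hc m
      exact ⟨i, a ⊗ₜ y, rfl⟩
    | add x y hx hy =>
      obtain ⟨i, x, rfl⟩ := hx
      obtain ⟨j, y, rfl⟩ := hy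
      obtain ⟨k, hik, hjk⟩ := exists_ge_ge i j
      refine ⟨k, (F.map (homOfLE hik)).hom.lTensor I x + (F.map (homOfLE hjk)).hom.lTensor I y, ?_⟩
      rw [map_add, ← LinearMap.lTensor_comp_apply, ← LinearMap.lTensor_comp_apply, hg, hg]
  intro x hx
  obtain ⟨i, y, rfl⟩ := hrep x
  let m : F.obj i := TensorProduct.lid R _ (I.subtype.rTensor _ y)
  have lid_lTensor {A B : Type u} [AddCommGroup A] [Module R A] [AddCommGroup B] [Module R B]
      (f : A →ₗ[R] B) (z : R ⊗[R] A) :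
      TensorProduct.lid R B (f.lTensor R z) = f (TensorProduct.lid R A z) := by
    induction z with
    | zero => simp
    | tmul a m => simp
    | add x y hx hy => simp [hx, hy]
  have hm : g i m = 0 := by
    rw [← lid_lTensor, ← rTensor_lTensor, hx, map_zero]
  obtain ⟨j, f, hj⟩ := (Limits.IsColimit.eq_iff' hc m 0).1 (hm.trans (map_zero (g i)).symm)
  replace hj : (F.map f).hom m = 0 := hj.trans (map_zero (F.map f).hom)
  rw [← lid_lTensor, ← rTensor_lTensor, LinearEquiv.map_eq_zero_iff] at hj
  have := map_mem_gvTorsion ((g j).lTensor I) (h j _ hj)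
  rwa [← LinearMap.lTensor_comp_apply, hg] at this

end Module.IsWFlatAt

namespace semiRegularWFlat

variable (R)

lemma closedUnderDirectLimits : (semiRegularWFlat R).ClosedUnderDirectLimits := by
  intro ι _ _ _
  refine ⟨fun X ⟨h⟩ => (semiRegularWFlat_iff X).2 fun I hI hI' => ?_⟩
  exact IsWFlatAt.of_isColimit h.isColimit fun i =>
    (semiRegularWFlat_iff _).1 (h.prop_diag_obj i) I hI hI'

lemma closedUnderPureSubmodules : (semiRegularWFlat R).ClosedUnderPureSubmodules :=
  fun _ N hN hM => (semiRegularWFlat_iff _).2 fun I hI hI' =>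
    ((semiRegularWFlat_iff _).1 hM I hI hI').of_injective_lTensor N.subtype (hN I)

lemma closedUnderPureQuotients : (semiRegularWFlat R).ClosedUnderPureQuotients :=
  fun M N hN hM => (semiRegularWFlat_iff _).2 fun I hI hI' =>
    ((semiRegularWFlat_iff M).1 hM I hI hI').quotient N (hN (R ⧸ I))

instance : (semiRegularWFlat R).IsClosedUnderIsomorphisms where
  of_iso e h := (semiRegularWFlat_iff _).2 fun I hI hI' =>
    ((semiRegularWFlat_iff _).1 h I hI hI').of_equiv e.symm.toLinearEquiv

lemma of_extension (M : ModuleCat.{u} R) (N : Submodule R M)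
    (h₁ : semiRegularWFlat R (ModuleCat.of R N))
    (h₂ : semiRegularWFlat R (ModuleCat.of R (M ⧸ N))) : semiRegularWFlat R M :=
  (semiRegularWFlat_iff _).2 fun I hI hI' =>
    IsWFlatAt.of_extension N ((semiRegularWFlat_iff _).1 h₁ I hI hI')
      ((semiRegularWFlat_iff _).1 h₂ I hI hI')

lemma directSum (ι : Type u) (M : ι → ModuleCat.{u} R) (h : ∀ i, semiRegularWFlat R (M i)) :
    semiRegularWFlat R (ModuleCat.of R (DirectSum ι fun i => M i)) :=
  (semiRegularWFlat_iff _).2 fun I hI hI' =>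
    IsWFlatAt.directSum fun i => (semiRegularWFlat_iff _).1 (h i) I hI hI'

end semiRegularWFlat

end WFlatAt

/-! ### Purity and small pure submodules. -/

section Purity

open TensorProduct Module

lemma Module.exists_eq_sum_tmul_of_span_range_eq_top {R Q N ι : Type*} [CommRing R]
    [AddCommGroup Q] [Module R Q] [AddCommGroup N] [Module R N] [Fintype ι] {m : ι → Q}
    (hm : Submodule.span R (Set.range m) = ⊤) (z : Q ⊗[R] N) :
    ∃ n : ι → N, z = ∑ i, m i ⊗ₜ n i := by
  induction z with
  | zero => exact ⟨0, by simp⟩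
  | tmul x y =>
    obtain ⟨c, rfl⟩ := (Submodule.mem_span_range_iff_exists_fun R).1
      (hm ▸ Submodule.mem_top : x ∈ Submodule.span R (Set.range m))
    exact ⟨fun i => c i • y, by simp [TensorProduct.sum_tmul, TensorProduct.smul_tmul]⟩
  | add x y hx hy =>
    obtain ⟨n, rfl⟩ := hx
    obtain ⟨n', rfl⟩ := hy
    exact ⟨n + n', by simp [TensorProduct.tmul_add, Finset.sum_add_distrib]⟩

namespace Submodule

variable {R : Type u} [CommRing R] {M : Type u} [AddCommGroup M] [Module R M]

/-- The equational criterion for purity. -/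
lemma isPure_of_solutions (N : Submodule R M)
    (h : ∀ (p q : ℕ) (a : Fin p → Fin q → R) (n : Fin p → M) (y : Fin q → M), (∀ i, n i ∈ N) →
      (∀ i, n i = ∑ j, a i j • y j) → ∃ y : Fin q → M, (∀ j, y j ∈ N) ∧
        ∀ i, n i = ∑ j, a i j • y j) : N.IsPure := by
  intro X _ _
  rw [injective_iff_map_eq_zero]
  intro z hz
  obtain ⟨P, hP, t, rfl⟩ := TensorProduct.exists_of_fg z
  rw [← IsWFlatAt.rTensor_lTensor] at hz
  -- The vanishing in X ⊗ M already happens over a finitely generated submodule of X.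
  obtain ⟨Q, hPQ, hQ, h'⟩ := TensorProduct.eq_of_fg_of_subtype_eq hP (hz.trans (map_zero _).symm)
  rw [map_zero, IsWFlatAt.rTensor_lTensor] at h'
  suffices (inclusion hPQ).rTensor N t = 0 by
    rw [← subtype_comp_inclusion _ _ hPQ, LinearMap.rTensor_comp_apply, this, map_zero]
  generalize (inclusion hPQ).rTensor N t = z at h'
  have : Module.Finite R Q := Module.Finite.iff_fg.2 hQ
  obtain ⟨p, m, hm⟩ := Module.Finite.exists_fin (R := R) (M := Q)
  obtain ⟨n, rfl⟩ := exists_eq_sum_tmul_of_span_range_eq_top hm z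
  rw [map_sum] at h'
  -- The vanishing is witnessed by a linear system with right-hand side in N and solution y in M. A
  -- solution in N witnesses it over N.
  obtain ⟨q, a, y, h₁, h₂⟩ := vanishesTrivially_of_sum_tmul_eq_zero R hm h'
  obtain ⟨y', hy', h₁'⟩ := h p q a (fun i => n i) y (fun i => (n i).2) h₁
  exact sum_tmul_eq_zero_of_vanishesTrivially R
    ⟨q, a, fun j => ⟨y' j, hy' j⟩, fun i => Subtype.ext (by simpa using h₁' i), h₂⟩

lemma IsPure.comap_mkQ {N : Submodule R M} (hN : N.IsPure) {Q : Submodule R (M ⧸ N)}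
    (hQ : Q.IsPure) : (Q.comap N.mkQ).IsPure := by
  intro X _ _
  rw [injective_iff_map_eq_zero]
  intro z hz
  let N' := Q.comap N.mkQ
  have hle : N ≤ N' := fun x hx => by simp [N', (Quotient.mk_eq_zero N).2 hx]
  let p : N' →ₗ[R] Q := N.mkQ.restrict fun x hx => hx
  have hp : Function.Surjective p := by
    rintro ⟨x, hx⟩
    obtain ⟨x, rfl⟩ := N.mkQ_surjective x
    exact ⟨⟨x, hx⟩, rfl⟩
  have hex : Function.Exact (inclusion hle) p := by
    rintro ⟨x, hx⟩
    constructor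
    · intro h
      exact ⟨⟨x, (Quotient.mk_eq_zero N).1 (congrArg Subtype.val h)⟩, rfl⟩
    · rintro ⟨y, hy⟩
      obtain rfl : (y : M) = x := congrArg Subtype.val hy
      exact Subtype.ext ((Quotient.mk_eq_zero N).2 y.2)
  have h1 : p.lTensor X z = 0 := by
    apply (injective_iff_map_eq_zero _).1 (hQ X)
    rw [← LinearMap.lTensor_comp_apply]
    change (N.mkQ ∘ₗ N'.subtype).lTensor X z = 0
    rw [LinearMap.lTensor_comp_apply, hz, map_zero]
  obtain ⟨n, rfl⟩ := (lTensor_exact X hex hp z).1 h1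
  rw [← LinearMap.lTensor_comp_apply, subtype_comp_inclusion] at hz
  rw [(injective_iff_map_eq_zero _).1 (hN X) n hz, map_zero]

lemma isPure_bot : (⊥ : Submodule R M).IsPure := by
  intro X _ _
  have : Subsingleton (X ⊗[R] (⊥ : Submodule R M)) := inferInstance
  exact Function.injective_of_subsingleton _

lemma isPure_iSup_of_directed {ι : Type*} [Nonempty ι] {N : ι → Submodule R M}
    (hN : Directed (· ≤ ·) N) (h : ∀ i, (N i).IsPure) : (⨆ i, N i).IsPure := by
  intro X _ _
  rw [injective_iff_map_eq_zero]
  intro z hz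
  obtain ⟨i, w, rfl⟩ : ∃ (i : ι) (w : X ⊗[R] N i), (inclusion (le_iSup N i)).lTensor X w = z := by
    clear hz
    induction z with
    | zero => exact ⟨Classical.arbitrary ι, 0, map_zero _⟩
    | tmul a m =>
      obtain ⟨i, hi⟩ := (mem_iSup_of_directed N hN).1 m.2
      exact ⟨i, a ⊗ₜ ⟨m, hi⟩, rfl⟩
    | add x y hx hy =>
      obtain ⟨i, x, rfl⟩ := hx
      obtain ⟨j, y, rfl⟩ := hy
      obtain ⟨k, hik, hjk⟩ := hN i j
      refine ⟨k, (inclusion hik).lTensor X x + (inclusion hjk).lTensor X y, ?_⟩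
      rw [map_add, ← LinearMap.lTensor_comp_apply, ← LinearMap.lTensor_comp_apply]
      rfl
  rw [← LinearMap.lTensor_comp_apply, subtype_comp_inclusion] at hz
  rw [(injective_iff_map_eq_zero _).1 (h i X) w hz, map_zero]

end Submodule

section Closure

open Cardinal

/-- The language of linear combinations and of solutions of finite systems of linear equations
over `R`. -/
def purityLanguage (R : Type u) : FirstOrder.Language.{u, 0} where
  Functions p := (Fin p → R) ⊕ (Σ q : ℕ, (Fin p → Fin q → R) × Fin q)
  Relations _ := Empty

lemma card_sigma_purityLanguage_functions_le (R : Type u) :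
    #(Σ p, (purityLanguage R).Functions p) ≤ max #R ℵ₀ := by
  have hκ : ℵ₀ ≤ max #R ℵ₀ := le_max_right _ _
  have key (f : ℕ → Type u) (hf : ∀ i, #(f i) ≤ max #R ℵ₀) : #(Σ i, f i) ≤ max #R ℵ₀ := by
    rw [mk_sigma]
    refine (sum_le_lift_mk_mul_iSup_lift _).trans (mul_le_of_le hκ (by simp) ?_)
    exact ciSup_le' fun i => by simpa using hf i
  have hpow (n : ℕ) : #(Fin n → R) ≤ max #R ℵ₀ := by
    simpa using power_nat_le_max (c := #R) (n := n)
  refine key _ fun p => ?_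
  change #((Fin p → R) ⊕ (Σ q : ℕ, (Fin p → Fin q → R) × Fin q)) ≤ _
  rw [mk_sum, lift_id, lift_id]
  refine add_le_of_le hκ (hpow p) (key _ fun q => ?_)
  rw [mk_prod]
  refine mul_le_of_le hκ ?_ ?_
  · rw [Cardinal.lift_uzero, ← mk_congr (Equiv.curry (Fin p) (Fin q) R)]
    rw [← mk_congr (Equiv.arrowCongr finProdFinEquiv.symm (Equiv.refl R))]
    exact hpow _
  · exact le_trans (by simp) hκ

variable {R : Type u} [CommRing R]

open scoped Classical in
/-- Interpretation of `purityLanguage R` in a module, given by a choice of solutions. -/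
noncomputable instance (M : Type u) [AddCommGroup M] [Module R M] :
    (purityLanguage R).Structure M where
  funMap f n := match f with
    | .inl r => ∑ i, r i • n i
    | .inr ⟨_, a, j⟩ =>
      if h : ∃ y : Fin _ → M, ∀ i, n i = ∑ j, a i j • y j then h.choose j else 0
  RelMap := Empty.elim

/-- Every element of a module lies in a pure submodule of bounded cardinality. -/
lemma Submodule.exists_isPure_mk_le {M : Type u} [AddCommGroup M] [Module R M] (x : M) :
    ∃ N : Submodule R M, x ∈ N ∧ N.IsPure ∧ #N ≤ max #R ℵ₀ := by
  -- Skolem hull of x: a finite system with right-hand side in S that is solvable in M has its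
  -- chosen solution in S.
  let S := FirstOrder.Language.Substructure.closure (purityLanguage R) {x}
  have hlin {p : ℕ} (r : Fin p → R) (n : Fin p → M) (hn : ∀ i, n i ∈ S) : ∑ i, r i • n i ∈ S :=
    S.fun_mem (n := p) (.inl r) n hn
  let N : Submodule R M :=
    { carrier := S
      zero_mem' := by simpa using hlin (p := 0) 0 0 (fun i => i.elim0)
      add_mem' {a b} ha hb := by
        simpa using hlin (p := 2) ![1, 1] ![a, b] (by simpa [Fin.forall_fin_two] using ⟨ha, hb⟩)
      smul_mem' r a ha := by
        simpa using hlin (p := 1) ![r] ![a] (by simpa using ha) }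
  refine ⟨N, FirstOrder.Language.Substructure.subset_closure rfl, isPure_of_solutions N ?_, ?_⟩
  · intro p q a n y hn hy
    have h : ∃ y : Fin q → M, ∀ i, n i = ∑ j, a i j • y j := ⟨y, hy⟩
    refine ⟨h.choose, fun j => ?_, h.choose_spec⟩
    have := S.fun_mem (n := p) (.inr ⟨q, a, j⟩) n hn
    rw [show FirstOrder.Language.Structure.funMap (L := purityLanguage R) (.inr ⟨q, a, j⟩) n =
      h.choose j from dif_pos h] at this
    exact this
  · have := FirstOrder.Language.Substructure.lift_card_closure_le (L := purityLanguage R)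
      (s := {x})
    rw [lift_id, lift_id, lift_id] at this
    refine this.trans (max_le (le_max_right _ _) (add_le_of_le (le_max_right _ _) ?_ ?_))
    · exact le_trans (by simp) (le_max_right _ _)
    · exact card_sigma_purityLanguage_functions_le R

end Closure

end Purity

/-! ### Monomorphisms with cokernel in the class. -/

section Precover

open Limits MorphismProperty Cardinal

variable {R : Type u} [CommRing R]

namespace CategoryTheory.ObjectProperty

variable {P : ObjectProperty (ModuleCat.{u} R)}

/-- A class closed under direct limits contains all stages of a transfinite sequence as soon as it
contains the first one and is preserved by the successor steps. -/
lemma ClosedUnderDirectLimits.of_isWellOrderContinuous (hP : P.ClosedUnderDirectLimits)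
    {J : Type u} [LinearOrder J] [OrderBot J] [SuccOrder J] [WellFoundedLT J]
    (F : J ⥤ ModuleCat.{u} R) [F.IsWellOrderContinuous] (h₀ : P (F.obj ⊥))
    (hs : ∀ j, ¬ IsMax j → P (F.obj j) → P (F.obj (Order.succ j))) (j : J) : P (F.obj j) := by
  induction j using SuccOrder.limitRecOn with
  | isMin j hj => rwa [hj.eq_bot]
  | succ j hj h => exact hs j hj h
  | isSuccLimit j hj h =>
    have := hj.nonempty_Iio.to_subtype
    have := hP (Set.Iio j)
    exact colimitsOfShape_le P (Set.Iio j) _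
      ⟨{ toColimitPresentation := ColimitPresentation.mk _ _ (F.isColimitOfIsWellOrderContinuous j hj)
         prop_diag_obj := fun i => h i i.2 }⟩

variable (P) in
/-- The monomorphisms whose cokernel is in `P`. -/
def monoWithCokernel : MorphismProperty (ModuleCat.{u} R) := fun _ B f =>
  Mono f ∧ P (ModuleCat.of R (B ⧸ LinearMap.range f.hom))

variable [P.IsClosedUnderIsomorphisms]

lemma monoWithCokernel.prop (hP : ∀ (M : ModuleCat.{u} R) (N : Submodule R M),
      P (ModuleCat.of R N) → P (ModuleCat.of R (M ⧸ N)) → P M)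
    {A B : ModuleCat.{u} R} {f : A ⟶ B} (hf : P.monoWithCokernel f) (hA : P A) : P B := by
  obtain ⟨_, hf⟩ := hf
  have hi : Function.Injective f.hom := (ModuleCat.mono_iff_injective f).1 inferInstance
  exact hP B _ (P.prop_of_iso (LinearEquiv.ofInjective f.hom hi).toModuleIso hA) hf

/-- Pushouts do not change the cokernel. The map φ, zero on one leg and the projection on the other,
induces the inverse. -/
lemma pushouts_monoWithCokernel_le : P.monoWithCokernel.pushouts ≤ P.monoWithCokernel := by
  rintro A' B' f ⟨A, B, g, t, b, ⟨_, hg⟩, sq⟩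
  refine ⟨(monomorphisms _).of_isPushout sq (monomorphisms.infer_property g), ?_⟩
  refine P.prop_of_iso (LinearEquiv.toModuleIso ?_) hg
  let φ : B' ⟶ ModuleCat.of R (B ⧸ LinearMap.range g.hom) :=
    sq.desc 0 (ModuleCat.ofHom (Submodule.mkQ _)) (by
      ext x
      exact ((Submodule.Quotient.mk_eq_zero (LinearMap.range g.hom)).2
        (LinearMap.mem_range_self _ x)).symm)
  have hφ₁ : φ.hom ∘ₗ f.hom = 0 := congrArg ModuleCat.Hom.hom (sq.inl_desc _ _ _)
  have hφ₂ : φ.hom ∘ₗ b.hom = Submodule.mkQ _ := congrArg ModuleCat.Hom.hom (sq.inr_desc _ _ _)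
  refine LinearEquiv.ofLinearMap
    (Submodule.mapQ _ _ b.hom ?_) (Submodule.liftQ _ φ.hom ?_) ?_ ?_
  · rintro _ ⟨x, rfl⟩
    exact ⟨t x, congr($(sq.w) x)⟩
  · rintro _ ⟨x, rfl⟩
    exact LinearMap.congr_fun hφ₁ x
  · refine Submodule.linearMap_qext _ ?_
    let ψ : B' ⟶ ModuleCat.of R (B' ⧸ LinearMap.range f.hom) :=
      φ ≫ ModuleCat.ofHom (Submodule.mapQ _ _ b.hom (by
        rintro _ ⟨x, rfl⟩
        exact ⟨t x, congr($(sq.w) x)⟩))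
    have : ψ = ModuleCat.ofHom (Submodule.mkQ _) := by
      refine sq.hom_ext ?_ ?_
      · ext x
        refine (congrArg _ (LinearMap.congr_fun hφ₁ x)).trans ((map_zero _).trans ?_)
        exact ((Submodule.Quotient.mk_eq_zero (LinearMap.range f.hom)).2
          (LinearMap.mem_range_self _ x)).symm
      · ext x
        exact congrArg _ (LinearMap.congr_fun hφ₂ x)
    exact congrArg ModuleCat.Hom.hom this
  · refine Submodule.linearMap_qext _ ?_
    ext x
    exact LinearMap.congr_fun hφ₂ x

/-- The cokernel of a coproduct of maps is the direct sum of their cokernels. -/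
lemma coproducts_monoWithCokernel_le
    (hP : ∀ (ι : Type u) (M : ι → ModuleCat.{u} R), (∀ i, P (M i)) →
      P (ModuleCat.of R (DirectSum ι fun i => M i))) :
    coproducts.{u} P.monoWithCokernel ≤ P.monoWithCokernel := by
  classical
  intro A B g hg
  refine ⟨?_, ?_⟩
  · have : coproducts.{u} P.monoWithCokernel ≤ monomorphisms _ := by
      rw [coproducts_le_iff]
      exact fun _ _ f hf => hf.1
    exact this g hg
  rw [coproducts_iff] at hg
  obtain ⟨J, hg⟩ := hg
  obtain ⟨X₁, X₂, c₁, c₂, h₁, h₂, f, hf⟩ := hg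
  generalize hφ' : h₁.desc (Cocone.mk _ (f ≫ c₂.ι)) = φ
  have hφ (j : Discrete J) : c₁.ι.app j ≫ φ = f.app j ≫ c₂.ι.app j := by
    rw [← hφ', h₁.fac]; rfl
  let Q (j : J) : ModuleCat.{u} R :=
    ModuleCat.of R (X₂.obj ⟨j⟩ ⧸ LinearMap.range (f.app ⟨j⟩).hom)
  have hQ := hP J Q fun j => (hf ⟨j⟩).2
  refine P.prop_of_iso (LinearEquiv.toModuleIso ?_) hQ
  let s : Cocone X₂ :=
    { pt := ModuleCat.of R (DirectSum J fun j => Q j)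
      ι := Discrete.natTrans fun j => ModuleCat.ofHom
        (DirectSum.lof R J (fun j => Q j) j.as ∘ₗ Submodule.mkQ _) }
  let ψ : c₂.pt →ₗ[R] DirectSum J fun j => Q j := (h₂.desc s).hom
  have hψ (j : J) (x : X₂.obj ⟨j⟩) : ψ (c₂.ι.app ⟨j⟩ x) =
      DirectSum.lof R J (fun j => Q j) j (Submodule.Quotient.mk x) :=
    congr($(h₂.fac s ⟨j⟩) x)
  have hker : LinearMap.range φ.hom ≤ LinearMap.ker ψ := by
    have : φ ≫ h₂.desc s = 0 := h₁.hom_ext fun ⟨j⟩ => by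
      refine ModuleCat.hom_ext (LinearMap.ext fun x => ?_)
      have h1 : φ (c₁.ι.app ⟨j⟩ x) = c₂.ι.app ⟨j⟩ (f.app ⟨j⟩ x) := congr($(hφ ⟨j⟩) x)
      change ψ (φ (c₁.ι.app ⟨j⟩ x)) = 0
      rw [h1, hψ]
      refine (congrArg _ ?_).trans (map_zero _)
      exact (Submodule.Quotient.mk_eq_zero _).2 ⟨x, rfl⟩
    rintro _ ⟨x, rfl⟩
    exact congr($this x)
  let χ (j : J) : Q j →ₗ[R] (c₂.pt ⧸ LinearMap.range φ.hom) :=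
    Submodule.mapQ _ _ (c₂.ι.app ⟨j⟩).hom (by
      rintro _ ⟨x, rfl⟩
      exact ⟨c₁.ι.app ⟨j⟩ x, congr($(hφ ⟨j⟩) x)⟩)
  refine LinearEquiv.ofLinearMap (DirectSum.toModule R J _ χ) (Submodule.liftQ _ ψ hker) ?_ ?_
  · refine Submodule.linearMap_qext _ ?_
    have : h₂.desc s ≫ ModuleCat.ofHom (DirectSum.toModule R J _ χ) =
        ModuleCat.ofHom (Submodule.mkQ _) := h₂.hom_ext fun ⟨j⟩ => by
      ext x
      change DirectSum.toModule R J _ χ (ψ (c₂.ι.app ⟨j⟩ x)) = _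
      rw [hψ, DirectSum.toModule_lof]
      rfl
    exact congrArg ModuleCat.Hom.hom this
  · refine DirectSum.linearMap_ext R fun j => Submodule.linearMap_qext _ ?_
    ext1 x
    change Submodule.liftQ _ ψ hker (DirectSum.toModule R J _ χ
      (DirectSum.lof R J (fun j => Q j) j (Submodule.Quotient.mk x))) =
        DirectSum.lof R J (fun j => Q j) j (Submodule.Quotient.mk x)
    rw [DirectSum.toModule_lof, ← hψ]
    rfl

end CategoryTheory.ObjectProperty

end Precover

/-! ### Precovers by the small object argument. -/

section PrecoverExistence

open Limits MorphismProperty Cardinal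

variable {R : Type u} [CommRing R]

namespace CategoryTheory.ObjectProperty

variable (P : ObjectProperty (ModuleCat.{u} R))

variable (R) in
/-- A free module with all modules of cardinality at most `max #R ℵ₀` as quotients. -/
noncomputable def testObject : ModuleCat.{u} R :=
  ModuleCat.of R ((max #R ℵ₀).ord.ToType →₀ R)

instance : Module.Projective R (testObject R) :=
  inferInstanceAs (Module.Projective R ((max #R ℵ₀).ord.ToType →₀ R))

lemma exists_surjective_testObject {N : Type u} [AddCommGroup N] [Module R N]
    (hN : #N ≤ max #R ℵ₀) : ∃ s : testObject R →ₗ[R] N, Function.Surjective s := by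
  obtain ⟨e⟩ : Nonempty (N ↪ (max #R ℵ₀).ord.ToType) := by
    exact (Cardinal.le_def _ _).1 (by rwa [mk_ord_toType])
  refine ⟨Finsupp.linearCombination R (Function.invFun e), fun n =>
    ⟨Finsupp.single (e n) (1 : R), (Finsupp.linearCombination_single R _ _).trans ?_⟩⟩
  rw [Function.leftInverse_invFun e.injective, one_smul]

/-- The inclusions of the submodules of `testObject R` whose quotient is in `P`. -/
def testMaps : MorphismProperty (ModuleCat.{u} R) :=
  ofHoms fun K : {K : Submodule R (testObject R) // P (ModuleCat.of R (testObject R ⧸ K))} =>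
    ModuleCat.ofHom K.1.subtype

variable {P} in
lemma testMaps.mk {K : Submodule R (testObject R)} (hK : P (ModuleCat.of R (testObject R ⧸ K))) :
    P.testMaps (ModuleCat.ofHom K.subtype) :=
  ofHoms.mk (f := fun K : {K : Submodule R (testObject R) //
    P (ModuleCat.of R (testObject R ⧸ K))} => ModuleCat.ofHom K.1.subtype) ⟨K, hK⟩

instance : IsSmall.{u} P.testMaps := by
  dsimp [testMaps]
  infer_instance

lemma testMaps_le_monomorphisms : P.testMaps ≤ monomorphisms _ := by
  rintro _ _ _ ⟨K⟩
  exact (ModuleCat.mono_iff_injective _).2 (Submodule.subtype_injective _)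

lemma testMaps_le_monoWithCokernel [P.IsClosedUnderIsomorphisms] :
    P.testMaps ≤ P.monoWithCokernel := by
  intro A B f hf
  refine ⟨testMaps_le_monomorphisms P f hf, ?_⟩
  obtain ⟨K⟩ := hf
  exact P.prop_of_iso (Submodule.quotEquivOfEq _ _ (Submodule.range_subtype _).symm).toModuleIso K.2

instance : HasSmallObjectArgument.{u} P.testMaps := by
  -- With κ above the number of subobjects of `testObject R`, maps out of any of its submodules
  -- commute with κ-indexed colimits of monomorphisms.
  obtain ⟨κ, hκ', hκ⟩ := HasCardinalLT.exists_regular_cardinal.{u} (Subobject (testObject R))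
  have : Fact κ.IsRegular := ⟨hκ'⟩
  have : Nonempty κ.ord.ToType := by simpa using hκ'.ne_zero
  have := WellFoundedLT.toOrderBot κ.ord.ToType
  exact ⟨κ, inferInstance, inferInstance,
    { preservesColimit {A B X Y} i hi f hf := by
        let hf' : (monomorphisms (ModuleCat.{u} R)).TransfiniteCompositionOfShape κ.ord.ToType f :=
          { toTransfiniteCompositionOfShape := hf.toTransfiniteCompositionOfShape
            map_mem j hj := by
              have := (hf.attachCells j hj).pushouts_coproducts
              rw [ofHoms_homFamily] at this
              exact pushouts_le_iff.2 (coproducts_le_iff.2 P.testMaps_le_monomorphisms) _ this }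
        have (j j' : κ.ord.ToType) (φ : j ⟶ j') : Mono (hf'.F.map φ) := hf'.mem_map φ
        apply IsGrothendieckAbelian.preservesColimit_coyoneda_obj_of_mono (Y := hf'.F) (κ := κ)
        have hi' := P.testMaps_le_monomorphisms i hi
        obtain ⟨K⟩ := hi
        exact @Subobject.hasCardinalLT_of_mono _ _ _ _ hκ _ _ ((monomorphisms.iff _).1 hi') }⟩

variable {P}

lemma exists_rlp_testMaps [P.IsClosedUnderIsomorphisms] (hlim : P.ClosedUnderDirectLimits)
    (hext : ∀ (M : ModuleCat.{u} R) (N : Submodule R M),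
      P (ModuleCat.of R N) → P (ModuleCat.of R (M ⧸ N)) → P M)
    (hsum : ∀ (ι : Type u) (M : ι → ModuleCat.{u} R), (∀ i, P (M i)) →
      P (ModuleCat.of R (DirectSum ι fun i => M i))) (M : ModuleCat.{u} R) :
    ∃ (F : ModuleCat.{u} R) (p : F ⟶ M), P F ∧ P.testMaps.rlp p := by
  have h₀ : P (ModuleCat.of R (DirectSum PEmpty.{u + 1} fun _ => R)) :=
    hsum PEmpty (fun _ => ModuleCat.of R R) (fun i => i.elim)
  let κ := P.testMaps.smallObjectκ
  have : Fact κ.IsRegular := smallObjectκ_isRegular _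
  let f : ModuleCat.of R (DirectSum PEmpty.{u + 1} fun _ => R) ⟶ M := 0
  refine ⟨SmallObject.obj P.testMaps κ f, SmallObject.πObj P.testMaps κ f, ?_,
    SmallObject.rlp_πObj P.testMaps κ f⟩
  obtain ⟨h⟩ := SmallObject.transfiniteCompositionsOfShape_ιObj P.testMaps κ f
  have hle : (coproducts.{u} P.testMaps).pushouts ≤ P.monoWithCokernel :=
    (pushouts_monotone ((coproducts_monotone P.testMaps_le_monoWithCokernel).trans
      (coproducts_monoWithCokernel_le hsum))).trans pushouts_monoWithCokernel_le
  have hF (j : κ.ord.ToType) : P (h.F.obj j) :=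
    hlim.of_isWellOrderContinuous h.F (P.prop_of_iso h.isoBot.symm h₀)
      (fun j hj hj' => (hle _ (h.map_mem j hj)).prop hext hj') j
  have := hlim κ.ord.ToType
  exact colimitsOfShape_le P κ.ord.ToType _
    ⟨{ toColimitPresentation := ColimitPresentation.mk _ _ h.isColimit
       prop_diag_obj := hF }⟩

lemma exists_lift_of_rlp_testMaps [P.IsClosedUnderIsomorphisms]
    (hsub : P.ClosedUnderPureSubmodules) (hquot : P.ClosedUnderPureQuotients)
    {F F' M : ModuleCat.{u} R} {p : F ⟶ M} (hp : P.testMaps.rlp p) (hF' : P F') (f : F' ⟶ M) :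
    ∃ g : F' ⟶ F, g ≫ p = f := by
  let S : Set (F' →ₗ.[R] F) := {φ | φ.domain.IsPure ∧ ∀ x : φ.domain, p (φ x) = f x}
  obtain ⟨φ, hφ⟩ : ∃ φ, Maximal (· ∈ S) φ := by
    refine zorn_le₀ S fun c hcS hc => ?_
    obtain rfl | hne := c.eq_empty_or_nonempty
    · refine ⟨⊥, ⟨Submodule.isPure_bot, ?_⟩, by simp⟩
      rintro ⟨x, hx⟩
      obtain rfl := (Submodule.mem_bot R).1 hx
      exact (map_zero p.hom).trans (map_zero f.hom).symm
    have hd : DirectedOn (· ≤ ·) c := hc.directedOn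
    have := hne.to_subtype
    refine ⟨LinearPMap.sSup c hd, ⟨?_, ?_⟩, fun ψ hψ => LinearPMap.le_sSup hd hψ⟩
    · rw [LinearPMap.domain_sSup, sSup_image']
      exact Submodule.isPure_iSup_of_directed
        (hd.directed_val.mono_comp _ LinearPMap.domain_mono.monotone) fun ψ => (hcS ψ.2).1
    · rintro ⟨x, hx⟩
      obtain ⟨ψ, hψ, hx'⟩ := (LinearPMap.mem_domain_sSup_iff hne hd).1 hx
      have h := LinearPMap.sSup_apply hd hψ ⟨x, hx'⟩
      exact (congrArg p h).trans ((hcS hψ).2 ⟨x, hx'⟩)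
  have htop : φ.domain = ⊤ := by
    by_contra hne
    obtain ⟨x, -, hx⟩ := SetLike.exists_of_lt (lt_top_iff_ne_top.2 hne)
    let N := φ.domain
    obtain ⟨Q, hxQ, hQ, hcard⟩ := Submodule.exists_isPure_mk_le (R := R) (N.mkQ x)
    obtain ⟨s, hs⟩ := exists_surjective_testObject hcard
    -- Lift the presentation of Q to F'. Then σ sends K into N, where φ is defined, and the lifting
    -- property extends φ ∘ σ from K to the whole test object.
    obtain ⟨σ, hσ⟩ := Module.projective_lifting_property N.mkQ (Q.subtype ∘ₗ s) N.mkQ_surjective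
    replace hσ (a : testObject R) : N.mkQ (σ a) = s a := LinearMap.congr_fun hσ a
    let K := LinearMap.ker s
    have hK : P (ModuleCat.of R (testObject R ⧸ K)) :=
      P.prop_of_iso (s.quotKerEquivOfSurjective hs).symm.toModuleIso
        (hsub (ModuleCat.of R (F' ⧸ N)) Q hQ (hquot F' N hφ.1.1 hF'))
    have hσK (a : testObject R) (ha : a ∈ K) : σ a ∈ N := by
      rw [← Submodule.Quotient.mk_eq_zero, ← Submodule.mkQ_apply, hσ, LinearMap.mem_ker.1 ha]
      rfl
    let t : K →ₗ[R] F := φ.toFun ∘ₗ σ.restrict hσK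
    have sq : CommSq (ModuleCat.ofHom t) (ModuleCat.ofHom K.subtype) p
        (ModuleCat.ofHom (f.hom ∘ₗ σ)) := ⟨by
      ext a
      exact hφ.1.2 ⟨σ a, hσK a a.2⟩⟩
    have : HasLiftingProperty (ModuleCat.ofHom K.subtype) p := hp _ (testMaps.mk hK)
    let l : testObject R →ₗ[R] F := sq.lift.hom
    have hl₁ (a : testObject R) (ha : a ∈ K) : l a = φ ⟨σ a, hσK a ha⟩ :=
      congr($(sq.fac_left) ⟨a, ha⟩)
    have hl₂ (a : testObject R) : p (l a) = f (σ a) := congr($(sq.fac_right) a)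
    let τ : (N × testObject R) →ₗ[R] F' := N.subtype.coprod σ
    -- φ and l agree on the overlap, so they glue to a partial map on N + im σ, the preimage of Q.
    have hτ : LinearMap.ker τ ≤ LinearMap.ker (φ.toFun.coprod l) := by
      rintro ⟨n, a⟩ h
      replace h : (n : F') + σ a = 0 := h
      have ha : a ∈ K := by
        have h1 := hσ a
        rw [← neg_eq_of_add_eq_zero_right h, map_neg, Submodule.mkQ_apply,
          (Submodule.Quotient.mk_eq_zero N).2 n.2, neg_zero] at h1
        exact Subtype.ext h1.symm
      change φ n + l a = 0
      rw [hl₁ a ha, ← LinearPMap.map_add]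
      have : n + ⟨σ a, hσK a ha⟩ = 0 := Subtype.ext h
      rw [this, LinearPMap.map_zero]
    let ψ : F' →ₗ.[R] F :=
      ⟨LinearMap.range τ, (LinearMap.ker τ).liftQ _ hτ ∘ₗ τ.quotKerEquivRange.symm.toLinearMap⟩
    have hψ (z : N × testObject R) (y : ψ.domain) (hy : τ z = y) : ψ y = φ z.1 + l z.2 := by
      have : y = τ.quotKerEquivRange (Submodule.Quotient.mk z) := Subtype.ext hy.symm
      change (LinearMap.ker τ).liftQ _ hτ (τ.quotKerEquivRange.symm y) = _
      rw [this, LinearEquiv.symm_apply_apply]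
      rfl
    have hdom : ψ.domain = Q.comap N.mkQ := by
      ext y
      constructor
      · rintro ⟨⟨n, a⟩, rfl⟩
        change N.mkQ (n + σ a) ∈ Q
        rw [map_add, hσ, Submodule.mkQ_apply, (Submodule.Quotient.mk_eq_zero N).2 n.2, zero_add]
        exact (s a).2
      · intro hy
        obtain ⟨a, ha⟩ := hs ⟨N.mkQ y, hy⟩
        have : y - σ a ∈ N := by
          rw [← Submodule.Quotient.mk_eq_zero, ← Submodule.mkQ_apply, map_sub, hσ, ha, sub_self]
        exact ⟨(⟨y - σ a, this⟩, a), sub_add_cancel _ _⟩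
    have hψS : ψ ∈ S := by
      refine ⟨hdom ▸ hφ.1.1.comap_mkQ hQ, ?_⟩
      rintro ⟨_, ⟨z, rfl⟩⟩
      rw [hψ z _ rfl]
      refine (map_add p.hom _ _).trans ?_
      refine (congrArg₂ _ (hφ.1.2 z.1) (hl₂ z.2)).trans ?_
      exact (map_add f.hom _ _).symm
    have hle : φ ≤ ψ := by
      refine ⟨fun n hn => ⟨(⟨n, hn⟩, 0), by simp [τ]⟩, fun n y hny => ?_⟩
      rw [hψ (n, 0) y (by simpa [τ] using hny), map_zero, add_zero]
    exact hx ((hφ.2 hψS hle).1 (by rw [hdom]; exact hxQ))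
  let e : F' →ₗ[R] φ.domain := LinearMap.codRestrict _ LinearMap.id fun x => htop ▸ trivial
  exact ⟨ModuleCat.ofHom (φ.toFun ∘ₗ e), by ext x; exact hφ.1.2 (e x)⟩

lemma exists_isPrecover [P.IsClosedUnderIsomorphisms] (hlim : P.ClosedUnderDirectLimits)
    (hsub : P.ClosedUnderPureSubmodules) (hquot : P.ClosedUnderPureQuotients)
    (hext : ∀ (M : ModuleCat.{u} R) (N : Submodule R M),
      P (ModuleCat.of R N) → P (ModuleCat.of R (M ⧸ N)) → P M)
    (hsum : ∀ (ι : Type u) (M : ι → ModuleCat.{u} R), (∀ i, P (M i)) →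
      P (ModuleCat.of R (DirectSum ι fun i => M i))) (M : ModuleCat.{u} R) :
    ∃ (F : ModuleCat.{u} R) (p : F ⟶ M), P.IsPrecover p := by
  obtain ⟨F, p, hF, hp⟩ := exists_rlp_testMaps hlim hext hsum M
  exact ⟨F, p, hF, fun F' hF' f => exists_lift_of_rlp_testMaps hsub hquot hp hF' f⟩

end CategoryTheory.ObjectProperty

end PrecoverExistence

/-! ### Weakly terminal objects with bijective endomorphisms. -/

section WeaklyTerminal

open Limits Cardinal

namespace CategoryTheory.Functor

section Types

variable {κ : Cardinal.{u}} {F : κ.ord.ToType ⥤ Type u}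

lemma map_homOfLE_trans_apply {i j k : κ.ord.ToType} (hij : i ≤ j) (hjk : j ≤ k) (x : F.obj i) :
    F.map (homOfLE (hij.trans hjk)) x = F.map (homOfLE hjk) (F.map (homOfLE hij) x) := by
  rw [← homOfLE_comp hij hjk, F.map_comp]
  rfl

variable [F.IsWellOrderContinuous]

lemma exists_map_eq_of_isSuccLimit {δ : κ.ord.ToType} (hδ : Order.IsSuccLimit δ) (x : F.obj δ) :
    ∃ (i : κ.ord.ToType) (hi : i < δ) (y : F.obj i), F.map (homOfLE hi.le) y = x := by
  obtain ⟨⟨i, hi⟩, y, hy⟩ :=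
    Types.jointly_surjective_of_isColimit (F.isColimitOfIsWellOrderContinuous δ hδ) x
  exact ⟨i, hi, y, hy⟩

variable [Fact κ.IsRegular] [OrderBot κ.ord.ToType]

lemma hasCardinalLT_obj_of_isWellOrderContinuous (h₀ : HasCardinalLT (F.obj ⊥) κ)
    (hs : ∀ j, ¬ IsMax j → HasCardinalLT (F.obj (Order.succ j)) κ) (j : κ.ord.ToType) :
    HasCardinalLT (F.obj j) κ := by
  induction j using SuccOrder.limitRecOn with
  | isMin j hj => rwa [hj.eq_bot]
  | succ j hj _ => exact hs j hj
  | isSuccLimit j hj h =>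
    have hj' : HasCardinalLT (Set.Iio j) κ := by
      rw [hasCardinalLT_iff_cardinal_mk_lt]
      exact (mk_Iio_lt j (by simp)).trans_eq (by simp)
    refine (hasCardinalLT_sigma (fun i : Set.Iio j => F.obj i) κ hj' fun i => h i i.2).of_surjective
      (fun x => F.map (homOfLE x.1.2.le) x.2) fun x => ?_
    obtain ⟨i, hi, y, hy⟩ := exists_map_eq_of_isSuccLimit hj x
    exact ⟨⟨⟨i, hi⟩, y⟩, hy⟩

/-- In a transfinite sequence of small sets, some stage injects into all later stages. -/
lemma exists_injective_map_of_isWellOrderContinuous (hκ : HasCardinalLT ℕ κ)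
    (h : ∀ j, HasCardinalLT (F.obj j) κ) :
    ∃ δ : κ.ord.ToType, ∀ (j : κ.ord.ToType) (hj : δ ≤ j),
      Function.Injective (F.map (homOfLE hj)) := by
  have hκ' : ℵ₀ ≤ κ := (Fact.out : κ.IsRegular).aleph0_le
  have : NoMaxOrder κ.ord.ToType := Cardinal.noMaxOrder hκ'
  -- There are fewer than κ pairs in F(i), so by regularity one stage k identifies every pair that
  -- is ever identified.
  have hg (i : κ.ord.ToType) : ∃ k, i < k ∧ ∀ (x y : F.obj i) (j : κ.ord.ToType) (hj : i ≤ j),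
      F.map (homOfLE hj) x = F.map (homOfLE hj) y →
        ∀ hk : i ≤ k, F.map (homOfLE hk) x = F.map (homOfLE hk) y := by
    let S := {p : F.obj i × F.obj i // ∃ (j : κ.ord.ToType) (hj : i ≤ j),
      F.map (homOfLE hj) p.1 = F.map (homOfLE hj) p.2}
    choose j hj hij using fun s : S => s.2
    have hS : HasCardinalLT S κ :=
      (hasCardinalLT_prod hκ' (h i) (h i)).of_injective _ Subtype.val_injective
    refine ⟨Order.succ (max i (IsCardinalFiltered.max j hS)),
      (le_max_left _ _).trans_lt (Order.lt_succ _), fun x y l hl hxy hk => ?_⟩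
    let s : S := ⟨(x, y), l, hl, hxy⟩
    have hle : j s ≤ Order.succ (max i (IsCardinalFiltered.max j hS)) :=
      ((leOfHom (IsCardinalFiltered.toMax j hS s)).trans (le_max_right _ _)).trans (Order.le_succ _)
    have h1 := congrArg (F.map (homOfLE hle)) (hij s)
    rwa [← map_homOfLE_trans_apply, ← map_homOfLE_trans_apply] at h1
  choose g hig hg using hg
  -- The supremum δ of the iterates of g works: elements of F(δ) come from some a(n), and pairs
  -- identified after δ are already identified at a(n + 1) < δ.
  let a (n : ℕ) : κ.ord.ToType := g^[n] ⊥
  have ha (n : ℕ) : a (n + 1) = g (a n) := Function.iterate_succ_apply' g n ⊥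
  have hlt (n : ℕ) : a n < a (n + 1) := (hig _).trans_eq (ha n).symm
  have hmono : Monotone a := monotone_nat_of_le_succ fun n => (hlt n).le
  have hne : (upperBounds (Set.range a)).Nonempty :=
    ⟨IsCardinalFiltered.max a hκ, by
      rintro _ ⟨n, rfl⟩
      exact leOfHom (IsCardinalFiltered.toMax a hκ n)⟩
  obtain ⟨δ, hδ, hmin⟩ := WellFounded.has_min (wellFounded_lt (α := κ.ord.ToType)) _ hne
  replace hmin (x : κ.ord.ToType) (hx : x < δ) : ∃ n, x < a n := by
    by_contra! hc
    exact hmin x (by rintro _ ⟨n, rfl⟩; exact hc n) hx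
  have haδ (n : ℕ) : a n < δ := (hlt n).trans_le (hδ ⟨n + 1, rfl⟩)
  have hlim : Order.IsSuccLimit δ := by
    refine ⟨fun h => (haδ 0).not_ge (h (haδ 0).le), fun x hx => ?_⟩
    obtain ⟨n, hn⟩ := hmin x hx.lt
    exact hx.2 hn (haδ n)
  have key (x : F.obj δ) : ∃ n, ∀ m, n ≤ m → ∃ y : F.obj (a m), F.map (homOfLE (haδ m).le) y = x := by
    obtain ⟨i, hi, y, rfl⟩ := exists_map_eq_of_isSuccLimit hlim x
    obtain ⟨n, hn⟩ := hmin i hi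
    exact ⟨n, fun m hm => ⟨F.map (homOfLE (hn.le.trans (hmono hm))) y,
      (map_homOfLE_trans_apply _ _ _).symm⟩⟩
  refine ⟨δ, fun j hj x y hxy => ?_⟩
  obtain ⟨n, hn⟩ := key x
  obtain ⟨n', hn'⟩ := key y
  obtain ⟨x, rfl⟩ := hn _ (le_max_left n n')
  obtain ⟨y, rfl⟩ := hn' _ (le_max_right n n')
  rw [← map_homOfLE_trans_apply, ← map_homOfLE_trans_apply] at hxy
  have hle : g (a (max n n')) ≤ δ := (ha _).symm.trans_le (haδ _).le
  have h1 := congrArg (F.map (homOfLE hle)) (hg _ x y _ _ hxy (hig _).le)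
  rwa [← map_homOfLE_trans_apply, ← map_homOfLE_trans_apply] at h1

end Types

universe v w

variable {C : Type v} [Category.{w} C] (U : C ⥤ Type u)

/-- The objects all of whose outgoing morphisms are injective. -/
def IsInitialMono (G : C) : Prop :=
  ∀ (Z : C) (g : G ⟶ Z), Function.Injective (U.map g)

variable {U} in
lemma IsInitialMono.of_iso {G G' : C} (h : U.IsInitialMono G) (e : G ≅ G') :
    U.IsInitialMono G' := fun Z g => by
  have h1 : U.map g = U.map e.inv ≫ U.map (e.hom ≫ g) := by
    rw [← U.map_comp, e.inv_hom_id_assoc]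
  rw [h1]
  exact (h Z _).comp (U.mapIso e).toEquiv.symm.injective

lemma hasIterationOfShape_of_directed
    (hC : ∀ (J : Type u) [Preorder J] [IsDirectedOrder J] [Nonempty J], HasColimitsOfShape J C)
    (J : Type u) [LinearOrder J] [Nonempty J] : HasIterationOfShape J C :=
  { hasColimitsOfShape_of_isSuccLimit j hj := by
      have := hj.nonempty_Iio.to_subtype
      exact hC _
    hasColimitsOfShape := hC _ }

variable {U} in
lemma preservesWellOrderContinuousOfShape_of_directed
    (hU : ∀ (J : Type u) [Preorder J] [IsDirectedOrder J] [Nonempty J],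
      PreservesColimitsOfShape J U)
    (J : Type u) [LinearOrder J] : PreservesWellOrderContinuousOfShape J U :=
  { preservesColimitsOfShape j hj := by
      have := hj.nonempty_Iio.to_subtype
      exact hU _ }

/-- Otherwise every object under W has a non-injective map to W. Iterating these gives a sequence
with successor stages isomorphic to W and no injective successor map, whereas some stage of a long
enough such sequence injects into all later ones. -/
lemma exists_isInitialMono
    (hC : ∀ (J : Type u) [Preorder J] [IsDirectedOrder J] [Nonempty J], HasColimitsOfShape J C)
    (hU : ∀ (J : Type u) [Preorder J] [IsDirectedOrder J] [Nonempty J],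
      PreservesColimitsOfShape J U) (W : C) (hW : ∀ X : C, Nonempty (X ⟶ W)) :
    ∃ G : C, Nonempty (W ⟶ G) ∧ U.IsInitialMono G := by
  by_contra! hc
  have ht (X : C) : ∃ t : X ⟶ W, Nonempty (W ⟶ X) → ¬ Function.Injective (U.map t) := by
    by_cases hX : Nonempty (W ⟶ X)
    · have h1 := hc X hX
      simp only [IsInitialMono, not_forall] at h1
      obtain ⟨Z, g, hg⟩ := h1
      refine ⟨g ≫ (hW Z).some, fun _ h => hg ?_⟩
      rw [U.map_comp] at h
      exact Function.Injective.of_comp h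
    · exact ⟨(hW X).some, fun h => (hX h).elim⟩
  choose t ht using ht
  let Φ : SmallObject.SuccStruct C := ⟨W, fun _ => W, t⟩
  obtain ⟨κ, hκ', hκ⟩ := HasCardinalLT.exists_regular_cardinal.{u} (U.obj W ⊕ ℕ)
  have : Fact κ.IsRegular := ⟨hκ'⟩
  have : Nonempty κ.ord.ToType := by simpa using hκ'.ne_zero
  have : NoMaxOrder κ.ord.ToType := Cardinal.noMaxOrder hκ'.aleph0_le
  let _ := WellFoundedLT.toOrderBot κ.ord.ToType
  have := hasIterationOfShape_of_directed hC κ.ord.ToType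
  have := preservesWellOrderContinuousOfShape_of_directed hU κ.ord.ToType
  have hWκ : HasCardinalLT (U.obj W) κ := hκ.of_injective _ Sum.inl_injective
  obtain ⟨δ, hδ⟩ := exists_injective_map_of_isWellOrderContinuous
    (F := Φ.iterationFunctor κ.ord.ToType ⋙ U) (hκ.of_injective _ Sum.inr_injective)
    (hasCardinalLT_obj_of_isWellOrderContinuous
      (hWκ.of_injective _ (U.mapIso (Φ.iterationFunctorObjBotIso _)).toEquiv.injective) fun j hj =>
      hWκ.of_injective _ (U.mapIso (Φ.iterationFunctorObjSuccIso j hj)).toEquiv.injective)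
  refine ht _ ⟨(Φ.ιIterationFunctor _).app δ⟩ ?_
  have h1 := hδ _ (Order.le_succ δ)
  rw [comp_map, Φ.iterationFunctor_map_succ δ (not_isMax δ), U.map_comp] at h1
  exact Function.Injective.of_comp h1

/-- Otherwise iterate non-surjective maps to G. All stages embed in G through the colimit, with
strictly increasing images, which is impossible for κ steps once κ exceeds the size of G. -/
lemma exists_forall_surjective
    (hC : ∀ (J : Type u) [Preorder J] [IsDirectedOrder J] [Nonempty J], HasColimitsOfShape J C)
    (hU : ∀ (J : Type u) [Preorder J] [IsDirectedOrder J] [Nonempty J],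
      PreservesColimitsOfShape J U) (G : C) (hG : U.IsInitialMono G)
    (hG' : ∀ X : C, Nonempty (X ⟶ G)) :
    ∃ X : C, Nonempty (G ⟶ X) ∧ U.IsInitialMono X ∧
      ∀ h : X ⟶ X, Function.Surjective (U.map h) := by
  by_contra! hc
  have ht (X : C) : ∃ t : X ⟶ G, Nonempty (G ⟶ X) → U.IsInitialMono X →
      ¬ Function.Surjective (U.map t) := by
    by_cases hX : Nonempty (G ⟶ X) ∧ U.IsInitialMono X
    · obtain ⟨h, hh⟩ := hc X hX.1 hX.2
      let s := (hG' X).some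
      refine ⟨h ≫ s, fun _ _ hs => hh fun x => ?_⟩
      obtain ⟨y, hy⟩ := hs (U.map s x)
      rw [U.map_comp] at hy
      exact ⟨y, hX.2 _ s hy⟩
    · exact ⟨(hG' X).some, fun h h' => (hX ⟨h, h'⟩).elim⟩
  choose t ht using ht
  let Φ : SmallObject.SuccStruct C := ⟨G, fun _ => G, t⟩
  obtain ⟨κ, hκ', hκ⟩ := HasCardinalLT.exists_regular_cardinal.{u} (U.obj G)
  have : Fact κ.IsRegular := ⟨hκ'⟩
  have : Nonempty κ.ord.ToType := by simpa using hκ'.ne_zero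
  have : NoMaxOrder κ.ord.ToType := Cardinal.noMaxOrder hκ'.aleph0_le
  let _ := WellFoundedLT.toOrderBot κ.ord.ToType
  have := hasIterationOfShape_of_directed hC κ.ord.ToType
  have := preservesWellOrderContinuousOfShape_of_directed hU κ.ord.ToType
  let F := Φ.iterationFunctor κ.ord.ToType
  have hF (j : κ.ord.ToType) : U.IsInitialMono (F.obj j) := by
    induction j using SuccOrder.limitRecOn with
    | isMin j hj =>
      obtain rfl := hj.eq_bot
      exact hG.of_iso (Φ.iterationFunctorObjBotIso _).symm
    | succ j hj _ => exact hG.of_iso (Φ.iterationFunctorObjSuccIso j hj).symm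
    | isSuccLimit j hj h =>
      intro Z g x y hxy
      obtain ⟨i, hi, x, rfl⟩ := exists_map_eq_of_isSuccLimit (F := F ⋙ U) hj x
      obtain ⟨i', hi', y, rfl⟩ := exists_map_eq_of_isSuccLimit (F := F ⋙ U) hj y
      rw [map_homOfLE_trans_apply (le_max_left i i') (max_lt hi hi').le,
        map_homOfLE_trans_apply (le_max_right i i') (max_lt hi hi').le] at hxy ⊢
      refine congrArg _ (h _ (max_lt hi hi') Z (F.map (homOfLE (max_lt hi hi').le) ≫ g) ?_)
      rw [U.map_comp]
      exact hxy
  let π : colimit F ⟶ G := (hG' _).some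
  let r (j : κ.ord.ToType) : Set (U.obj G) := Set.range (U.map (colimit.ι F j ≫ π))
  have hr {i j : κ.ord.ToType} (hij : i ≤ j) : r i ⊆ r j := by
    rintro _ ⟨x, rfl⟩
    refine ⟨U.map (F.map (homOfLE hij)) x, ?_⟩
    rw [← colimit.w F (homOfLE hij), Category.assoc, U.map_comp (F.map _)]
    rfl
  have hsucc (j : κ.ord.ToType) : ∃ y ∈ r (Order.succ j), y ∉ r j := by
    by_contra! hj
    refine ht (F.obj j) ⟨(Φ.ιIterationFunctor _).app j⟩ (hF j) ?_
    have h1 : Function.Surjective (U.map (F.map (homOfLE (Order.le_succ j)))) := fun x => by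
      obtain ⟨y, hy⟩ := hj _ ⟨x, rfl⟩
      refine ⟨y, hF _ _ _ (Eq.trans ?_ hy)⟩
      rw [← colimit.w F (homOfLE (Order.le_succ j)), Category.assoc, U.map_comp (F.map _)]
      rfl
    have h2 : t (F.obj j) = F.map (homOfLE (Order.le_succ j)) ≫
        (Φ.iterationFunctorObjSuccIso j (not_isMax j)).hom := by
      rw [Φ.iterationFunctor_map_succ j (not_isMax j), Category.assoc, Iso.inv_hom_id,
        Category.comp_id]
    rw [h2, U.map_comp]
    exact (U.mapIso (Φ.iterationFunctorObjSuccIso j (not_isMax j))).toEquiv.surjective.comp h1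
  -- A point new at each step injects κ into G.
  choose e he he' using hsucc
  have hinj : Function.Injective e := by
    refine .of_lt_imp_ne fun i j hij h => he' j ?_
    rw [← h]
    exact hr (Order.succ_le_of_lt hij) (he i)
  have h1 := hκ.of_injective _ hinj
  rw [hasCardinalLT_iff_cardinal_mk_lt, mk_ord_toType] at h1
  exact h1.false

/-- In a category with directed colimits, every weakly terminal object can be replaced by one
all of whose endomorphisms are bijective. -/
lemma exists_forall_endomorphism_bijective
    (hC : ∀ (J : Type u) [Preorder J] [IsDirectedOrder J] [Nonempty J], HasColimitsOfShape J C)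
    (hU : ∀ (J : Type u) [Preorder J] [IsDirectedOrder J] [Nonempty J],
      PreservesColimitsOfShape J U) (W : C) (hW : ∀ X : C, Nonempty (X ⟶ W)) :
    ∃ X : C, Nonempty (W ⟶ X) ∧ ∀ h : X ⟶ X, Function.Bijective (U.map h) := by
  obtain ⟨G, ⟨s⟩, hG⟩ := U.exists_isInitialMono hC hU W hW
  obtain ⟨X, ⟨s'⟩, hX, hX'⟩ := U.exists_forall_surjective hC hU G hG fun X => ⟨(hW X).some ≫ s⟩
  exact ⟨X, ⟨s ≫ s'⟩, fun h => ⟨hX X h, hX' h⟩⟩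

end CategoryTheory.Functor

end WeaklyTerminal

/-! ### From precovers to covers. -/

section Covers

open Limits

variable {R : Type u} [CommRing R] {P : ObjectProperty (ModuleCat.{u} R)}

namespace CategoryTheory.ObjectProperty

/-- Over a class of modules closed under direct limits, precovers give covers. -/
lemma ClosedUnderDirectLimits.exists_isCover (hP : P.ClosedUnderDirectLimits)
    {F M : ModuleCat.{u} R} {f : F ⟶ M} (hf : P.IsPrecover f) :
    ∃ (G : ModuleCat.{u} R) (g : G ⟶ M), P.IsCover g := by
  let Q : ObjectProperty (Over M) := P.inverseImage (Over.forget M)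
  have hQ (J : Type u) [Preorder J] [IsDirectedOrder J] [Nonempty J] :
      Q.IsClosedUnderColimitsOfShape J := by
    have := hP J
    infer_instance
  let U : Q.FullSubcategory ⥤ Type u := Q.ι ⋙ Over.forget M ⋙ forget _
  -- Being a precover means being weakly terminal here. The map s from the precover to X makes X a
  -- precover too.
  obtain ⟨X, ⟨s⟩, hX⟩ := U.exists_forall_endomorphism_bijective
    (fun J _ _ _ => by have := hQ J; infer_instance)
    (fun J _ _ _ => by have := hQ J; infer_instance)
    ⟨Over.mk f, hf.1⟩ fun X => by
      obtain ⟨g, hg⟩ := hf.2 _ X.2 X.obj.hom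
      exact ⟨ObjectProperty.homMk (Over.homMk g hg)⟩
  refine ⟨X.obj.left, X.obj.hom, ⟨X.2, fun F' hF' p => ?_⟩, fun h hh => ?_⟩
  · obtain ⟨g, hg⟩ := hf.2 F' hF' p
    refine ⟨g ≫ s.hom.left, ?_⟩
    have := Over.w s.hom
    dsimp at this hg ⊢
    rw [Category.assoc, this, hg]
  · have h1 := hX (ObjectProperty.homMk (Over.homMk h hh))
    exact (ConcreteCategory.isIso_iff_bijective h).2 h1

end CategoryTheory.ObjectProperty

/-- Semi-regular `w`-flat modules form a covering class. -/
lemma semiRegularWFlat.isCovering (R : Type u) [CommRing R] : (semiRegularWFlat R).IsCovering :=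
  fun M => by
    obtain ⟨F, p, hp⟩ := ObjectProperty.exists_isPrecover
      (semiRegularWFlat.closedUnderDirectLimits R) (semiRegularWFlat.closedUnderPureSubmodules R)
      (semiRegularWFlat.closedUnderPureQuotients R)
      (fun M N h₁ h₂ => semiRegularWFlat.of_extension R M N h₁ h₂)
      (fun ι M h => semiRegularWFlat.directSum R ι M h) M
    exact (semiRegularWFlat.closedUnderDirectLimits R).exists_isCover hp

end Covers

theorem proposition2p5 (R : Type u) [CommRing R] :
    (semiRegularWFlat R).ClosedUnderDirectLimits ∧
    (semiRegularWFlat R).ClosedUnderPureSubmodules ∧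
    (semiRegularWFlat R).ClosedUnderPureQuotients ∧
    (semiRegularWFlat R).IsCovering :=
  ⟨semiRegularWFlat.closedUnderDirectLimits R, semiRegularWFlat.closedUnderPureSubmodules R,
    semiRegularWFlat.closedUnderPureQuotients R, semiRegularWFlat.isCovering R⟩
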